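/- **Theorem 1.** Let $\mathcal X,\mathcal S,\mathcal Y$ be finite nonempty alphabets, $P_S$ a PMF on $\mathcal S$, and $P(y\mid x,s)$ a transition probability from $\mathcal X\times\mathcal S$ to $\mathcal Y$. Over $n$ uses with input $x^n$, the state and output sequences have joint law $\Pr[S^n=s^n,Y^n=y^n\mid X^n=x^n]=\prod_{i=1}^n P_S(s_i)P(y_i\mid x_i,s_i)$. Let $d:\mathcal S\times\mathcal S\to[0,\infty)$. An $(M,n)$-code consists of an encoder $f_n:\{1,\dots,M\}\to\mathcal X^n$, a decoder $g_n:\mathcal Y^n\to\{1,\dots,M\}$ and a state estimator $h_n:\mathcal Y^n\to\mathcal S^n$ (so neither the source nor the destination knows the state); with $\hat S^n=h_n(Y^n)$, put $$P_e^{(n)}=\frac1M\sum_{m=1}^M\Pr[g_n(Y^n)\ne m\mid X^n=f_n(m)],\qquad \bar d^{(n)}=\frac1M\sum_{m=1}^M\mathbf E\Big[\frac1n\sum_{i=1}^n d(S_i,\hat S_i)\,\Big|\,X^n=f_n(m)\Big].$$ A pair $(R,D)$ of reals is achievable if there are $(\lceil e^{nR}\rceil,n)$-codes, $n=1,2,\dots$,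 with $\lim_{n\to\infty} P_e^{(n)}=0$ and $\limsup_{n\to\infty}\bar d^{(n)}\le D$. The capacity-distortion function $C(D)$ is the supremum of all $R$ such that $(R,D)$ is achievable. For $x\in\mathcal X$ let $$d^*(x)=\min_{h:\mathcal X\times\mathcal Y\to\mathcal S}\ \sum_{s\in\mathcal S}\sum_{y\in\mathcal Y}P_S(s)P(y\mid x,s)\,d(s,h(x,y)),$$ and for $D\ge 0$ let $\mathcal P_D$ be the set of PMFs $P_X$ on $\mathcal X$ with $\sum_{x}P_X(x)d^*(x)\le D$. Then, for every $D\ge\min_{x}d^*(x)$, $$C(D)=\max_{P_X\in\mathcal P_D} I(X;Y)$$ (the maximum is attained), where $I(X;Y)$ is the mutual information in nats of the input $X\sim P_X$ and the output $Y$ of the state-averaged channel $\Pr[Y=y\mid X=x]=\sum_{s}P_S(s)P(y\mid x,s)$. For $0\le D<\min_x d^*(x)$, $\mathcal P_D$ is empty and no pair $(R,D)$ is achievable. -/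

import Mathlib

open Filter Topology

noncomputable section

namespace CapacityDistortion

/-- A discrete memoryless state-dependent channel with finite input, state and output alphabets
`X`, `S`, `Y`: the PMF `P_S` of the state and the transition probabilities `W x s y = P(y | x, s)`. -/
structure StateChannel (X S Y : Type*) [Fintype S] [Fintype Y] where
  /-- the state PMF `P_S` -/
  stateProb : S → ℝ
  /-- the transition probabilities, `trans x s y = P(y | x, s)` -/
  trans : X → S → Y → ℝ
  stateProb_mem : stateProb ∈ stdSimplex ℝ S
  trans_mem : ∀ x s, trans x s ∈ stdSimplex ℝ Y

/-- An `(M, n)`-code: encoder, decoder and state estimator. Neither the encoder nor the decoder nor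
the estimator has access to the state; messages are `Fin M`. -/
structure Code (X S Y : Type*) (M n : ℕ) where
  encode : Fin M → (Fin n → X)
  decode : (Fin n → Y) → Fin M
  estimate : (Fin n → Y) → (Fin n → S)

/-- Mutual information (in nats) of a joint PMF `q` on `X × Y`:
`∑ q(x,y) log (q(x,y) / (q(x) q(y)))`, where terms with `q(x,y) = 0` vanish. -/
def mutualInfo {X Y : Type*} [Fintype X] [Fintype Y] (q : X → Y → ℝ) : ℝ :=
  ∑ x, ∑ y, q x y * Real.log (q x y / ((∑ y', q x y') * (∑ x', q x' y)))

namespace StateChannel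

variable {X S Y : Type*} [Fintype X] [Fintype S] [Fintype Y]

/-- `Pr[S^n = s, Y^n = y | X^n = x]`: the states are i.i.d. with law `P_S`, independent of the input,
and the channel transitions are mutually independent. -/
def blockProb (W : StateChannel X S Y) {n : ℕ} (x : Fin n → X) (s : Fin n → S) (y : Fin n → Y) : ℝ :=
  (∏ i, W.stateProb (s i)) * ∏ i, W.trans (x i) (s i) (y i)

/-- Average probability of decoding error under a uniformly distributed message. -/
def errorProb (W : StateChannel X S Y) {M n : ℕ} (c : Code X S Y M n) : ℝ :=
  (1 / (M : ℝ)) * ∑ m : Fin M, ∑ s : Fin n → S, ∑ y : Fin n → Y,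
    if c.decode y ≠ m then W.blockProb (c.encode m) s y else 0

/-- Average distortion of the state estimate under a uniformly distributed message. -/
def avgDistortion (W : StateChannel X S Y) (d : S → S → ℝ) {M n : ℕ} (c : Code X S Y M n) : ℝ :=
  (1 / (M : ℝ)) * ∑ m : Fin M, ∑ s : Fin n → S, ∑ y : Fin n → Y,
    W.blockProb (c.encode m) s y * ((1 / (n : ℝ)) * ∑ i, d (s i) (c.estimate y i))

/-- `(R, D)` is achievable: there are `(⌈e^{nR}⌉, n)`-codes with vanishing error probability and
`limsup` of the average distortion at most `D`. (The degenerate blocklength `0`, for which a code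
always exists, does not matter in the limit. The average distortions are bounded.) -/
def Achievable (W : StateChannel X S Y) (d : S → S → ℝ) (R D : ℝ) : Prop :=
  ∃ c : ∀ n : ℕ, Code X S Y ⌈Real.exp (n * R)⌉₊ n,
    Tendsto (fun n => W.errorProb (c n)) atTop (𝓝 0) ∧
    limsup (fun n => W.avgDistortion d (c n)) atTop ≤ D

/-- The capacity-distortion function `C(D)`: the supremum of the rates `R` such that `(R, D)` is
achievable, in the extended reals, so that it is `⊥ = -∞` if there is no such rate. -/
def capacityDistortion (W : StateChannel X S Y) (d : S → S → ℝ) (D : ℝ) : EReal :=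
  sSup {r : EReal | ∃ R : ℝ, W.Achievable d R D ∧ r = (R : EReal)}

/-- The estimation cost `d*(x) = min_h E[d(S, h(X, Y)) | X = x]` over one-shot estimators
`h : X × Y → S`; the minimum is over finitely many values. -/
def estimationCost (W : StateChannel X S Y) (d : S → S → ℝ) (x : X) : ℝ :=
  ⨅ h : X → Y → S, ∑ s, ∑ y, W.stateProb s * W.trans x s y * d s (h x y)

/-- The set `𝒫_D` of input PMFs with `∑ P(x) d*(x) ≤ D`. -/
def admissible (W : StateChannel X S Y) (d : S → S → ℝ) (D : ℝ) : Set (X → ℝ) :=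
  {P | P ∈ stdSimplex ℝ X ∧ ∑ x, P x * W.estimationCost d x ≤ D}

/-- `Pr[Y = y | X = x]`, the channel marginalised over the state. -/
def marginal (W : StateChannel X S Y) (x : X) (y : Y) : ℝ :=
  ∑ s, W.stateProb s * W.trans x s y

/-- `I(X; Y)` when `X` has PMF `P` and `Y` is the output of the state-marginalised channel. -/
def inputInfo (W : StateChannel X S Y) (P : X → ℝ) : ℝ :=
  mutualInfo fun x y => P x * W.marginal x y

end StateChannel

end CapacityDistortion

end

namespace CapacityDistortion

/-! Converse. Reveal the whole input word to the estimator. Given that word, the pairs (state,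
output) at distinct positions are independent, so position `i` costs at least `d*(x i)`
(`estimationCost_le_sum_blockProb`). The distortion of a code is therefore at least the mean of `d*`
under the empirical law of its codeword letters, and a Fano-type inequality bounds its rate by the
information of the same law (`one_sub_errorProb_mul_log_le`). A limit point of these laws in the
compact simplex is admissible at `D` itself and has information at least `R`
(`Achievable.exists_admissible`).

Achievability. For admissible `P` and `R < I(P)`, draw codewords i.i.d. from `P`. The receiver
decodes, re-encodes, and applies the best one-letter estimator to the decoded input and the output.
This attains the revealed-input bound up to a multiple of the error probability
(`avgDistortion_le`). Averaging cost plus `K` times error over the random code yields one code good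
for both (`exists_code_avgInput_add_error_le`). -/

/-! ### Sums over product spaces and elementary facts about the channel. -/

theorem sum_pi_prod {ι α : Type*} [Fintype ι] [DecidableEq ι] [Fintype α] (f : ι → α → ℝ) :
    ∑ x : ι → α, ∏ i, f i (x i) = ∏ i, ∑ a, f i a := by
  rw [Finset.prod_univ_sum, Fintype.piFinset_univ]

/-- `F` replaces the `i`-th factor outright and need not be a multiple of `p i`; the unnormalised
letter costs enter in this form. -/
theorem sum_pi_mul_prod_erase {ι α : Type*} [Fintype ι] [DecidableEq ι] [Fintype α]
    (p : ι → α → ℝ) (i : ι) (F : α → ℝ) :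
    ∑ x : ι → α, F (x i) * ∏ j ∈ Finset.univ.erase i, p j (x j) =
      (∑ a, F a) * ∏ j ∈ Finset.univ.erase i, ∑ a, p j a := by
  have h := sum_pi_prod (fun j a => if j = i then F a else p j a)
  rw [← Finset.mul_prod_erase _ _ (Finset.mem_univ i)] at h
  simp only [if_true] at h
  rw [Finset.prod_congr rfl (g := fun j => ∑ a, p j a)
    (fun j hj => by simp [Finset.ne_of_mem_erase hj])] at h
  rw [← h]
  refine Finset.sum_congr rfl fun x _ => ?_
  rw [← Finset.mul_prod_erase _ _ (Finset.mem_univ i)]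
  simp only [if_true]
  congr 1
  exact Finset.prod_congr rfl fun j hj => by simp [Finset.ne_of_mem_erase hj]

theorem sum_pi_prod_mul {ι α : Type*} [Fintype ι] [DecidableEq ι] [Fintype α]
    (p : ι → α → ℝ) (i : ι) (F : α → ℝ) :
    ∑ x : ι → α, (∏ j, p j (x j)) * F (x i) =
      (∑ a, p i a * F a) * ∏ j ∈ Finset.univ.erase i, ∑ a, p j a := by
  rw [← sum_pi_mul_prod_erase p i (fun a => p i a * F a)]
  refine Finset.sum_congr rfl fun x _ => ?_
  rw [← Finset.mul_prod_erase _ _ (Finset.mem_univ i)]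
  ring

theorem sum_pi_prod_mul_of_sum_eq_one {ι α : Type*} [Fintype ι] [DecidableEq ι] [Fintype α]
    {p : ι → α → ℝ} (hp : ∀ i, ∑ a, p i a = 1) (i : ι) (F : α → ℝ) :
    ∑ x : ι → α, (∏ j, p j (x j)) * F (x i) = ∑ a, p i a * F a := by
  simp [sum_pi_prod_mul, hp]

/-- Independence of two coordinates: in random coding, the transmitted codeword and a competitor. -/
theorem sum_pi_prod_mul_mul {ι α : Type*} [Fintype ι] [DecidableEq ι] [Fintype α]
    {p : α → ℝ} (hp : ∑ a, p a = 1) {i j : ι} (hij : i ≠ j) (F G : α → ℝ) :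
    ∑ x : ι → α, (∏ k, p (x k)) * (F (x i) * G (x j)) = (∑ a, p a * F a) * ∑ a, p a * G a := by
  have h := sum_pi_prod (fun (k : ι) a => p a * ((if k = i then F a else 1) * if k = j then G a else 1))
  rw [Finset.prod_eq_mul i j hij (fun k _ hk => by simp [hk.1, hk.2, hp]) (by simp) (by simp)] at h
  simp only [hij, hij.symm, if_true, if_false, one_mul, mul_one] at h
  rw [← h]
  refine Finset.sum_congr rfl fun x _ => ?_
  rw [Finset.prod_mul_distrib, Finset.prod_mul_distrib]
  simp

namespace StateChannel
variable {X S Y : Type*} [Fintype S] [Fintype Y]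

theorem stateProb_nonneg (W : StateChannel X S Y) (s : S) : 0 ≤ W.stateProb s :=
  W.stateProb_mem.1 s

theorem trans_nonneg (W : StateChannel X S Y) (x : X) (s : S) (y : Y) : 0 ≤ W.trans x s y :=
  (W.trans_mem x s).1 y

theorem nonempty_state (W : StateChannel X S Y) : Nonempty S := by
  by_contra h
  rw [not_nonempty_iff] at h
  simpa using W.stateProb_mem.2

theorem marginal_mem (W : StateChannel X S Y) (x : X) : W.marginal x ∈ stdSimplex ℝ Y := by
  refine ⟨fun y => Finset.sum_nonneg fun s _ =>
    mul_nonneg (W.stateProb_nonneg s) (W.trans_nonneg x s y), ?_⟩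
  simp only [marginal]
  rw [Finset.sum_comm]
  simp only [← Finset.mul_sum, (W.trans_mem x _).2, mul_one, W.stateProb_mem.2]

end StateChannel

theorem exists_le_of_sum_mul_le {ι : Type*} [Fintype ι] {w J : ι → ℝ} {c : ℝ}
    (hw : ∀ i, 0 ≤ w i) (h1 : ∑ i, w i = 1) (h : ∑ i, w i * J i ≤ c) : ∃ i, J i ≤ c := by
  by_contra! hc
  have hpos : ∃ i ∈ Finset.univ, 0 < w i := by
    by_contra! h0
    linarith [Finset.sum_nonpos h0]
  have : ∑ i, w i * c < ∑ i, w i * J i := by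
    obtain ⟨i, hi, hwi⟩ := hpos
    exact Finset.sum_lt_sum (fun j _ => mul_le_mul_of_nonneg_left (hc j).le (hw j))
      ⟨i, hi, mul_lt_mul_of_pos_left (hc i) hwi⟩
  rw [← Finset.sum_mul, h1] at this
  linarith

/-! ### Random coding and the Chernoff bound. -/

/-- Random coding with a maximum likelihood decoder: the error probability is bounded by the
probability that the likelihood ratio is below the threshold `γ`, plus `(M - 1) / γ`. -/
theorem exists_code_cost_add_error_le {A B : Type*} [Fintype A] [Fintype B] {p : A → ℝ}
    {V : A → B → ℝ} (hp : p ∈ stdSimplex ℝ A) (hV : ∀ x, V x ∈ stdSimplex ℝ B) (β : A → ℝ)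
    {M : ℕ} (hM : 0 < M) {γ K : ℝ} (hγ : 0 < γ) (hK : 0 ≤ K) :
    ∃ (e : Fin M → A) (g : B → Fin M),
      (1 / (M : ℝ)) * ∑ m, β (e m) +
        K * ((1 / (M : ℝ)) * ∑ m, ∑ y, if g y ≠ m then V (e m) y else 0) ≤
      ∑ x, p x * β x +
        K * (∑ x, p x * (∑ y, if V x y < γ * ∑ x', p x' * V x' y then V x y else 0) +
          ((M : ℝ) - 1) / γ) := by
  have hM' : (M : ℝ) ≠ 0 := by positivity
  have : Nonempty (Fin M) := ⟨⟨0, hM⟩⟩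
  set q : B → ℝ := fun y => ∑ x', p x' * V x' y with hq
  have hq1 : ∑ y, q y = 1 := by
    simp only [hq]
    rw [Finset.sum_comm]
    simp [← Finset.mul_sum, (hV _).2, hp.2]
  set T : A → ℝ := fun x => ∑ y, if V x y < γ * q y then V x y else 0 with hT
  set G : B → A → ℝ := fun y x => if γ * q y ≤ V x y then 1 else 0 with hG
  have hG0 : ∀ y x, 0 ≤ G y x := fun y x => by simp only [hG]; split_ifs <;> norm_num
  set U : (Fin M → A) → Fin M → ℝ := fun e m =>
    T (e m) + ∑ m' ∈ Finset.univ.erase m, ∑ y, V (e m) y * G y (e m') with hU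
  -- the deterministic bound for the maximum likelihood decoder
  have hdet : ∀ e : Fin M → A, ∃ g : B → Fin M, ∀ m,
      (∑ y, if g y ≠ m then V (e m) y else 0) ≤ U e m := by
    intro e
    choose g hg using fun y => Finite.exists_max fun m => V (e m) y
    refine ⟨g, fun m => ?_⟩
    simp only [hU, hT]
    rw [Finset.sum_comm, ← Finset.sum_add_distrib]
    refine Finset.sum_le_sum fun y _ => ?_
    have hv := (hV (e m)).1 y
    have hs : 0 ≤ ∑ m' ∈ Finset.univ.erase m, V (e m) y * G y (e m') :=
      Finset.sum_nonneg fun m' _ => mul_nonneg hv (hG0 _ _)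
    by_cases h1 : g y = m
    · simp only [h1, ne_eq, not_true_eq_false, if_false]
      split_ifs <;> linarith
    · simp only [h1, ne_eq, not_false_eq_true, if_true]
      by_cases h2 : V (e m) y < γ * q y
      · simp only [h2, if_true]; linarith
      · simp only [h2, if_false, zero_add]
        -- The decoder prefers a wrong codeword only if it is at least as likely as the transmitted
        -- one, so it passes the threshold too and is counted in the union bound.
        have h3 : γ * q y ≤ V (e (g y)) y := (not_lt.1 h2).trans (hg y m)
        have := Finset.single_le_sum (f := fun m' => V (e m) y * G y (e m'))
          (fun m' _ => mul_nonneg hv (hG0 _ _))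
          (Finset.mem_erase.2 ⟨h1, Finset.mem_univ (g y)⟩)
        simpa [hG, h3] using this
  choose g hg using hdet
  set w : (Fin M → A) → ℝ := fun e => ∏ m, p (e m) with hw
  have hw0 : ∀ e, 0 ≤ w e := fun e => Finset.prod_nonneg fun m _ => hp.1 _
  have hw1 : ∑ e, w e = 1 := by
    simp only [hw]
    rw [sum_pi_prod fun _ : Fin M => p]
    simp [hp.2]
  have hEone : ∀ (F : A → ℝ) m, ∑ e, w e * F (e m) = ∑ x, p x * F x := fun F m =>
    sum_pi_prod_mul_of_sum_eq_one (p := fun _ => p) (fun _ => hp.2) m F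
  have hEpair : ∀ m, ∀ m' ∈ Finset.univ.erase m,
      ∑ e, w e * ∑ y, V (e m) y * G y (e m') ≤ 1 / γ := by
    intro m m' hm'
    simp only [Finset.mul_sum]
    rw [Finset.sum_comm]
    have h1 : ∀ y, ∑ e, w e * (V (e m) y * G y (e m')) = q y * ∑ x, p x * G y x := fun y =>
      sum_pi_prod_mul_mul hp.2 (Finset.ne_of_mem_erase hm').symm (fun x => V x y) (G y)
    simp only [h1]
    -- Markov's inequality in the form `q y * G y x ≤ V x y / γ`, which also covers `q y = 0`.
    calc ∑ y, q y * ∑ x, p x * G y x ≤ ∑ y, q y / γ := by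
          refine Finset.sum_le_sum fun y _ => ?_
          rw [Finset.mul_sum, hq, Finset.sum_div]
          refine Finset.sum_le_sum fun x _ => ?_
          rw [mul_left_comm, mul_div_assoc]
          refine mul_le_mul_of_nonneg_left ?_ (hp.1 x)
          simp only [hG]
          rw [le_div_iff₀ hγ]
          split_ifs with h
          · simpa [mul_comm] using h
          · simpa using (hV x).1 y
      _ = 1 / γ := by rw [← Finset.sum_div, hq1]
  have hEU : ∀ m, ∑ e, w e * U e m ≤ ∑ x, p x * T x + ((M : ℝ) - 1) / γ := by
    intro m
    simp only [hU, mul_add, Finset.sum_add_distrib]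
    rw [hEone T m]
    simp only [Finset.mul_sum (Finset.univ.erase m)]
    rw [Finset.sum_comm (t := Finset.univ.erase m)]
    have := Finset.sum_le_sum (hEpair m)
    simp only [Finset.sum_const, Finset.card_erase_of_mem (Finset.mem_univ m), Finset.card_univ,
      Fintype.card_fin, nsmul_eq_mul, Nat.cast_pred hM] at this
    rw [mul_one_div] at this
    linarith
  have hfin : ∑ e, w e * ((1 / (M : ℝ)) * ∑ m, β (e m) + K * ((1 / (M : ℝ)) * ∑ m, U e m)) ≤
      ∑ x, p x * β x + K * (∑ x, p x * T x + ((M : ℝ) - 1) / γ) := by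
    have e1 : ∑ e, w e * ((1 / (M : ℝ)) * ∑ m, β (e m) + K * ((1 / (M : ℝ)) * ∑ m, U e m)) =
        (1 / (M : ℝ)) * ∑ m : Fin M, ∑ e, w e * β (e m) +
          K * ((1 / (M : ℝ)) * ∑ m : Fin M, ∑ e, w e * U e m) := by
      rw [Finset.sum_comm, Finset.sum_comm (f := fun m e => w e * U e m)]
      simp only [Finset.mul_sum, ← Finset.sum_add_distrib]
      refine Finset.sum_congr rfl fun e _ => ?_
      exact Finset.sum_congr rfl fun m _ => by ring
    rw [e1]
    simp only [hEone β]
    have e2 : ∑ m : Fin M, ∑ e, w e * U e m ≤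
        M * (∑ x, p x * T x + ((M : ℝ) - 1) / γ) := by
      refine (Finset.sum_le_sum fun m _ => hEU m).trans_eq ?_
      rw [Finset.sum_const, Finset.card_univ, Fintype.card_fin, nsmul_eq_mul]
    have e3 : (1 / (M : ℝ)) * ∑ m : Fin M, ∑ e, w e * U e m ≤
        ∑ x, p x * T x + ((M : ℝ) - 1) / γ := by
      rw [one_div, inv_mul_le_iff₀ (by positivity)]
      exact e2
    have e4 : (1 / (M : ℝ)) * ∑ m : Fin M, ∑ x, p x * β x = ∑ x, p x * β x := by
      simp only [Finset.sum_const, Finset.card_univ, Fintype.card_fin, nsmul_eq_mul]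
      field_simp
    rw [e4]
    gcongr
  obtain ⟨e, he⟩ := exists_le_of_sum_mul_le hw0 hw1 hfin
  refine ⟨e, g e, le_trans ?_ he⟩
  gcongr with m _
  exact hg e m

/-- Chernoff bound for the likelihood ratio of the `n`-fold product of a channel. -/
theorem sum_prod_lt_le_pow {X Y : Type*} [Fintype X] [Fintype Y] {P : X → ℝ}
    {V : X → Y → ℝ} {q : Y → ℝ} (hP : ∀ x, 0 ≤ P x) (hV : ∀ x y, 0 ≤ V x y)
    (hq : ∀ y, 0 ≤ q y) (n : ℕ) {a t : ℝ} (ht : 0 ≤ t) :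
    ∑ x : Fin n → X, (∏ i, P (x i)) * (∑ y : Fin n → Y,
      if ∏ i, V (x i) (y i) < Real.exp (n * a) * ∏ i, q (y i) then ∏ i, V (x i) (y i) else 0) ≤
    (∑ x, P x * ∑ y, V x y * (Real.exp a * q y / V x y) ^ t) ^ n := by
  have e1 : (∑ x, P x * ∑ y, V x y * (Real.exp a * q y / V x y) ^ t) ^ n =
      ∑ x : Fin n → X, (∏ i, P (x i)) * ∑ y : Fin n → Y,
        ∏ i, (V (x i) (y i) * (Real.exp a * q (y i) / V (x i) (y i)) ^ t) := by
    have h1 : ∀ x : Fin n → X, ∑ y : Fin n → Y,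
        ∏ i, (V (x i) (y i) * (Real.exp a * q (y i) / V (x i) (y i)) ^ t) =
        ∏ i, ∑ y, V (x i) y * (Real.exp a * q y / V (x i) y) ^ t := fun x =>
      sum_pi_prod fun i y => V (x i) y * (Real.exp a * q y / V (x i) y) ^ t
    simp only [h1, ← Finset.prod_mul_distrib]
    rw [sum_pi_prod fun (_ : Fin n) x => P x * ∑ y, V x y * (Real.exp a * q y / V x y) ^ t]
    simp
  rw [e1]
  refine Finset.sum_le_sum fun x _ => mul_le_mul_of_nonneg_left
    (Finset.sum_le_sum fun y _ => ?_) (Finset.prod_nonneg fun i _ => hP _)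
  have hr : ∀ i, 0 ≤ Real.exp a * q (y i) / V (x i) (y i) := fun i =>
    div_nonneg (mul_nonneg (Real.exp_pos a).le (hq _)) (hV _ _)
  split_ifs with h
  · rw [Finset.prod_mul_distrib, Real.finsetProd_rpow _ _ fun i _ => hr i]
    rcases (Finset.prod_nonneg fun i (_ : i ∈ Finset.univ) => hV (x i) (y i)).eq_or_lt with h0 | h0
    · simp [← h0]
    -- On this event the product of the ratios is at least 1, hence so is its `t`-th power.
    · refine le_mul_of_one_le_right h0.le (Real.one_le_rpow ?_ ht)
      rw [Finset.prod_div_distrib, Finset.prod_mul_distrib]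
      simp only [Finset.prod_const, Finset.card_univ, Fintype.card_fin, ← Real.exp_nat_mul]
      rw [le_div_iff₀ h0, one_mul]
      exact h.le
  · exact Finset.prod_nonneg fun i _ => mul_nonneg (hV _ _) (Real.rpow_nonneg (hr i) t)

/-! ### Optimal estimation and the distortion of a code. -/

namespace StateChannel
variable {X S Y : Type*} [Fintype S] [Fintype Y]

/-- Unnormalised conditional expected distortion of the estimate `t` given `X = x` and `Y = y`. -/
def letterCost (W : StateChannel X S Y) (d : S → S → ℝ) (x : X) (y : Y) (t : S) : ℝ :=
  ∑ s, W.stateProb s * W.trans x s y * d s t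

/-- The cost is a sum of terms each involving a single value of the estimator, so minimising
separately for each pair of letters is optimal for all `x` at once. -/
theorem exists_optimal_estimator (W : StateChannel X S Y) (d : S → S → ℝ) :
    ∃ h : X → Y → S, (∀ x y t, W.letterCost d x y (h x y) ≤ W.letterCost d x y t) ∧
      ∀ x, W.estimationCost d x = ∑ y, W.letterCost d x y (h x y) := by
  have := W.nonempty_state
  choose h hh using fun x y => Finite.exists_min (W.letterCost d x y)
  have key : ∀ (g : X → Y → S) x, ∑ s, ∑ y, W.stateProb s * W.trans x s y * d s (g x y) =
      ∑ y, W.letterCost d x y (g x y) := fun g x => Finset.sum_comm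
  refine ⟨h, hh, fun x => ?_⟩
  simp only [estimationCost, key]
  have hle : ∀ g : X → Y → S, ∑ y, W.letterCost d x y (h x y) ≤ ∑ y, W.letterCost d x y (g x y) :=
    fun g => Finset.sum_le_sum fun y _ => hh x y _
  refine le_antisymm (ciInf_le ⟨∑ y, W.letterCost d x y (h x y), ?_⟩ h) (le_ciInf hle)
  rintro _ ⟨g, rfl⟩
  exact hle g

theorem letterCost_nonneg (W : StateChannel X S Y) {d : S → S → ℝ} (hd : ∀ s s', 0 ≤ d s s')
    (x : X) (y : Y) (t : S) : 0 ≤ W.letterCost d x y t :=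
  Finset.sum_nonneg fun s _ =>
    mul_nonneg (mul_nonneg (W.stateProb_nonneg s) (W.trans_nonneg x s y)) (hd s t)

theorem estimationCost_nonneg (W : StateChannel X S Y) {d : S → S → ℝ}
    (hd : ∀ s s', 0 ≤ d s s') (x : X) : 0 ≤ W.estimationCost d x := by
  obtain ⟨h, -, h2⟩ := W.exists_optimal_estimator d
  rw [h2]
  exact Finset.sum_nonneg fun y _ => W.letterCost_nonneg hd x y _

theorem blockProb_nonneg (W : StateChannel X S Y) {n : ℕ} (x : Fin n → X) (s : Fin n → S)
    (y : Fin n → Y) : 0 ≤ W.blockProb x s y :=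
  mul_nonneg (Finset.prod_nonneg fun _ _ => W.stateProb_nonneg _)
    (Finset.prod_nonneg fun _ _ => W.trans_nonneg _ _ _)

theorem sum_blockProb (W : StateChannel X S Y) {n : ℕ} (x : Fin n → X) (y : Fin n → Y) :
    ∑ s, W.blockProb x s y = ∏ i, W.marginal (x i) (y i) := by
  simp only [blockProb, ← Finset.prod_mul_distrib, marginal]
  exact sum_pi_prod fun i s => W.stateProb s * W.trans (x i) s (y i)

theorem sum_sum_ite_blockProb (W : StateChannel X S Y) {n : ℕ} (x : Fin n → X)
    (p : (Fin n → Y) → Prop) [DecidablePred p] :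
    ∑ s, ∑ y, (if p y then W.blockProb x s y else 0) =
      ∑ y, if p y then ∏ i, W.marginal (x i) (y i) else 0 := by
  rw [Finset.sum_comm]
  refine Finset.sum_congr rfl fun y _ => ?_
  split_ifs
  · exact W.sum_blockProb x y
  · simp

theorem errorProb_eq (W : StateChannel X S Y) {M n : ℕ} (c : Code X S Y M n) :
    W.errorProb c = (1 / (M : ℝ)) * ∑ m : Fin M, ∑ y : Fin n → Y,
      if c.decode y ≠ m then ∏ i, W.marginal (c.encode m i) (y i) else 0 := by
  simp only [errorProb, sum_sum_ite_blockProb W _ (fun y => c.decode y ≠ _)]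

theorem sum_blockProb_mul (W : StateChannel X S Y) (d : S → S → ℝ) {n : ℕ} (x : Fin n → X)
    (y : Fin n → Y) (i : Fin n) (t : S) :
    ∑ s, W.blockProb x s y * d (s i) t =
      W.letterCost d (x i) (y i) t * ∏ j ∈ Finset.univ.erase i, W.marginal (x j) (y j) := by
  simp only [blockProb, ← Finset.prod_mul_distrib, marginal, letterCost]
  exact sum_pi_prod_mul (fun j s => W.stateProb s * W.trans (x j) s (y j)) i fun s => d s t

theorem sum_letterCost_mul_prod_erase (W : StateChannel X S Y) {d : S → S → ℝ} {h : X → Y → S}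
    (hh : ∀ x, W.estimationCost d x = ∑ y, W.letterCost d x y (h x y)) {n : ℕ}
    (x : Fin n → X) (i : Fin n) :
    ∑ y : Fin n → Y, W.letterCost d (x i) (y i) (h (x i) (y i)) *
      ∏ j ∈ Finset.univ.erase i, W.marginal (x j) (y j) = W.estimationCost d (x i) := by
  rw [sum_pi_mul_prod_erase (fun j => W.marginal (x j)) i
    (fun y => W.letterCost d (x i) y (h (x i) y)), hh]
  simp [(W.marginal_mem _).2]

theorem sum_blockProb_mul_optimal (W : StateChannel X S Y) {d : S → S → ℝ} {h : X → Y → S}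
    (hh : ∀ x, W.estimationCost d x = ∑ y, W.letterCost d x y (h x y)) {n : ℕ}
    (x : Fin n → X) (i : Fin n) :
    ∑ s, ∑ y, W.blockProb x s y * d (s i) (h (x i) (y i)) = W.estimationCost d (x i) := by
  rw [Finset.sum_comm]
  simp only [sum_blockProb_mul]
  exact W.sum_letterCost_mul_prod_erase hh x i

/-- Once the states are summed out, outputs at other positions act only as nonnegative weights. For
each fixed `y`, the estimate costs at least the optimal letter for the input and output at position
`i`. -/
theorem estimationCost_le_sum_blockProb (W : StateChannel X S Y) (d : S → S → ℝ) {n : ℕ}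
    (x : Fin n → X) (i : Fin n) (e : (Fin n → Y) → S) :
    W.estimationCost d (x i) ≤ ∑ s, ∑ y, W.blockProb x s y * d (s i) (e y) := by
  obtain ⟨h, h1, h2⟩ := W.exists_optimal_estimator d
  rw [← W.sum_letterCost_mul_prod_erase h2 x i, Finset.sum_comm]
  simp only [sum_blockProb_mul]
  exact Finset.sum_le_sum fun y _ => mul_le_mul_of_nonneg_right (h1 _ _ _)
    (Finset.prod_nonneg fun j _ => (W.marginal_mem _).1 _)

/-- Average over the messages and positions of a cost of the channel input. -/
noncomputable def avgInput {M n : ℕ} (e : Fin M → Fin n → X) (b : X → ℝ) : ℝ :=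
  (1 / (M : ℝ)) * ∑ m, (1 / (n : ℝ)) * ∑ i, b (e m i)

theorem avgDistortion_eq (W : StateChannel X S Y) (d : S → S → ℝ) {M n : ℕ}
    (c : Code X S Y M n) :
    W.avgDistortion d c = (1 / (M : ℝ)) * ∑ m, (1 / (n : ℝ)) * ∑ i, ∑ s, ∑ y,
      W.blockProb (c.encode m) s y * d (s i) (c.estimate y i) := by
  unfold avgDistortion
  congr 1
  refine Finset.sum_congr rfl fun m _ => ?_
  rw [Finset.sum_comm, Finset.mul_sum]
  simp only [Finset.mul_sum]
  rw [Finset.sum_comm]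
  conv_lhs => enter [2, s]; rw [Finset.sum_comm]
  rw [Finset.sum_comm]
  refine Finset.sum_congr rfl fun i _ => Finset.sum_congr rfl fun s _ =>
    Finset.sum_congr rfl fun y _ => ?_
  ring

theorem avgInput_le_avgDistortion (W : StateChannel X S Y) (d : S → S → ℝ) {M n : ℕ}
    (c : Code X S Y M n) :
    avgInput c.encode (W.estimationCost d) ≤ W.avgDistortion d c := by
  rw [avgDistortion_eq, avgInput]
  gcongr with m _ i _
  exact W.estimationCost_le_sum_blockProb d (c.encode m) i fun y => c.estimate y i

/-- When decoding is correct, the re-encoded word is the true input and the estimator is the optimal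
one; otherwise the distortion is at most `B`. -/
theorem avgDistortion_le (W : StateChannel X S Y) {d : S → S → ℝ} {B : ℝ}
    (hd : ∀ s s', 0 ≤ d s s') (hB : ∀ s s', d s s' ≤ B) {h : X → Y → S}
    (hh : ∀ x, W.estimationCost d x = ∑ y, W.letterCost d x y (h x y)) {M n : ℕ}
    (hn : n ≠ 0) (e : Fin M → Fin n → X) (g : (Fin n → Y) → Fin M) :
    W.avgDistortion d ⟨e, g, fun y i => h (e (g y) i) (y i)⟩ ≤
      avgInput e (W.estimationCost d) + B * W.errorProb ⟨e, g, fun y i => h (e (g y) i) (y i)⟩ := by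
  rw [avgDistortion_eq, avgInput, errorProb, mul_left_comm B, ← mul_add,
    Finset.mul_sum Finset.univ _ B, ← Finset.sum_add_distrib]
  gcongr with m _
  simp only
  set E := ∑ s : Fin n → S, ∑ y : Fin n → Y, if g y ≠ m then W.blockProb (e m) s y else 0 with hE
  have hn' : (n : ℝ) ≠ 0 := by exact_mod_cast hn
  have : (1 / (n : ℝ)) * ∑ i : Fin n, W.estimationCost d (e m i) + B * E =
      (1 / (n : ℝ)) * ∑ i : Fin n, (W.estimationCost d (e m i) + B * E) := by
    rw [Finset.sum_add_distrib]; simp; field_simp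
  rw [this]
  gcongr with i _
  rw [← W.sum_blockProb_mul_optimal hh (e m) i, hE, Finset.mul_sum, ← Finset.sum_add_distrib]
  refine Finset.sum_le_sum fun s _ => ?_
  rw [Finset.mul_sum, ← Finset.sum_add_distrib]
  refine Finset.sum_le_sum fun y _ => ?_
  have hb := W.blockProb_nonneg (e m) s y
  by_cases hg : g y = m
  · simp [hg]
  · simp only [ne_eq, hg, not_false_eq_true, if_true]
    have h1 := mul_le_mul_of_nonneg_left (hB (s i) (h (e (g y) i) (y i))) hb
    have h2 := mul_nonneg hb (hd (s i) (h (e m i) (y i)))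
    linarith

end StateChannel

/-! ### Mutual information and the converse. -/

/-- This is `log z ≤ z - 1` at `z = r * q / v`. Summed over an alphabet, it bounds a relative
entropy from below by means of a test function `r`. -/
theorem mul_log_le_mul_log_div_add {v q r : ℝ} (hv : 0 ≤ v) (hq : 0 ≤ q) (hr : 0 < r)
    (h : q = 0 → v = 0) : v * Real.log r ≤ v * Real.log (v / q) + (r * q - v) := by
  rcases hv.eq_or_lt with rfl | hv
  · simpa using mul_nonneg hr.le hq
  have hq' : 0 < q := hq.lt_of_ne' fun h0 => hv.ne' (h h0)
  have h1 := mul_le_mul_of_nonneg_left (Real.log_le_sub_one_of_pos (x := r * q / v) (by positivity))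
    hv.le
  rw [Real.log_div (by positivity) hv.ne', Real.log_mul hr.ne' hq'.ne', mul_sub v _ 1,
    mul_div_cancel₀ _ hv.ne'] at h1
  rw [Real.log_div hv.ne' hq'.ne']
  linarith

namespace StateChannel
variable {X S Y : Type*} [Fintype X] [Fintype S] [Fintype Y]

/-- The output distribution of the state-averaged channel when the input has law `P`. -/
def output (W : StateChannel X S Y) (P : X → ℝ) (y : Y) : ℝ := ∑ x, P x * W.marginal x y

theorem output_mem (W : StateChannel X S Y) {P : X → ℝ} (hP : P ∈ stdSimplex ℝ X) :
    W.output P ∈ stdSimplex ℝ Y := by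
  refine ⟨fun y => Finset.sum_nonneg fun x _ => mul_nonneg (hP.1 x) ((W.marginal_mem x).1 y), ?_⟩
  simp only [output]
  rw [Finset.sum_comm]
  simp [← Finset.mul_sum, (W.marginal_mem _).2, hP.2]

theorem output_pos (W : StateChannel X S Y) {P : X → ℝ} (hP : P ∈ stdSimplex ℝ X) {x : X} {y : Y}
    (hx : P x ≠ 0) (hxy : W.marginal x y ≠ 0) : 0 < W.output P y :=
  Finset.sum_pos' (fun x _ => mul_nonneg (hP.1 x) ((W.marginal_mem x).1 y))
    ⟨x, Finset.mem_univ x, mul_pos ((hP.1 x).lt_of_ne' hx) (((W.marginal_mem x).1 y).lt_of_ne' hxy)⟩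

theorem inputInfo_eq (W : StateChannel X S Y) (P : X → ℝ) :
    W.inputInfo P =
      ∑ x, P x * ∑ y, W.marginal x y * Real.log (W.marginal x y / W.output P y) := by
  unfold inputInfo mutualInfo
  refine Finset.sum_congr rfl fun x _ => ?_
  rw [Finset.mul_sum]
  refine Finset.sum_congr rfl fun y _ => ?_
  rw [← Finset.mul_sum, (W.marginal_mem x).2, mul_one]
  by_cases hx : P x = 0
  · simp [hx]
  · rw [mul_div_mul_left _ _ hx, mul_assoc]
    rfl

/-- Output entropy minus conditional entropy: `negMulLog` is continuous at 0, which makes continuity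
on the simplex evident. -/
theorem inputInfo_eq_sub (W : StateChannel X S Y) {P : X → ℝ} (hP : P ∈ stdSimplex ℝ X) :
    W.inputInfo P = ∑ y, Real.negMulLog (∑ x, P x * W.marginal x y) -
      ∑ x, P x * ∑ y, Real.negMulLog (W.marginal x y) := by
  have h1 : ∑ y, Real.negMulLog (∑ x, P x * W.marginal x y) =
      -∑ x, P x * ∑ y, W.marginal x y * Real.log (W.output P y) := by
    simp only [Finset.mul_sum, ← Finset.sum_neg_distrib]
    rw [Finset.sum_comm]
    refine Finset.sum_congr rfl fun y _ => ?_
    rw [Real.negMulLog, Finset.sum_neg_distrib, neg_mul, Finset.sum_mul]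
    simp only [output, mul_assoc]
  rw [inputInfo_eq, h1, neg_sub_left, ← Finset.sum_add_distrib, ← Finset.sum_neg_distrib]
  refine Finset.sum_congr rfl fun x _ => ?_
  rw [← mul_add, ← mul_neg, ← Finset.sum_add_distrib, ← Finset.sum_neg_distrib]
  by_cases hx : P x = 0
  · simp [hx]
  congr 1
  refine Finset.sum_congr rfl fun y _ => ?_
  by_cases hv : W.marginal x y = 0
  · simp [hv]
  rw [Real.log_div hv (W.output_pos hP hx hv).ne', Real.negMulLog]
  ring

theorem continuousOn_inputInfo (W : StateChannel X S Y) :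
    ContinuousOn W.inputInfo (stdSimplex ℝ X) := by
  refine ContinuousOn.congr (Continuous.continuousOn ?_) fun P hP => W.inputInfo_eq_sub hP
  refine Continuous.sub (continuous_finsetSum _ fun y _ => Real.continuous_negMulLog.comp ?_) ?_ <;>
  fun_prop

/-- The average empirical distribution of the letters of the codewords. -/
noncomputable def empirical {M n : ℕ} (e : Fin M → Fin n → X) (x : X) : ℝ := by
  classical exact avgInput e fun x' => if x' = x then 1 else 0

theorem sum_empirical_mul {M n : ℕ} (e : Fin M → Fin n → X) (F : X → ℝ) :
    ∑ x, empirical e x * F x = avgInput e F := by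
  classical
  simp only [empirical, avgInput, Finset.mul_sum, Finset.sum_mul]
  rw [Finset.sum_comm]
  refine Finset.sum_congr rfl fun m _ => ?_
  rw [Finset.sum_comm]
  refine Finset.sum_congr rfl fun i _ => ?_
  rw [Finset.sum_eq_single (e m i)]
  · simp [mul_assoc]
  · intro x _ hx
    simp [hx.symm]
  · simp

theorem empirical_mem {M n : ℕ} (hM : M ≠ 0) (hn : n ≠ 0) (e : Fin M → Fin n → X) :
    empirical e ∈ stdSimplex ℝ X := by
  classical
  constructor
  · intro x
    simp only [empirical, avgInput]
    refine mul_nonneg (by positivity) (Finset.sum_nonneg fun m _ =>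
      mul_nonneg (by positivity) (Finset.sum_nonneg fun i _ => ?_))
    split_ifs <;> norm_num
  · have h := sum_empirical_mul e fun _ => 1
    simp only [mul_one] at h
    have hM' : (M : ℝ) ≠ 0 := by exact_mod_cast hM
    have hn' : (n : ℝ) ≠ 0 := by exact_mod_cast hn
    rw [h, avgInput]
    simp [hM', hn']

-- Ensures that the output law of the empirical distribution is positive wherever some codeword
-- letter can lead, so the log-likelihood ratios in the converse are genuine.
omit [Fintype X] in
theorem empirical_ne_zero {M n : ℕ} (hM : M ≠ 0) (hn : n ≠ 0) (e : Fin M → Fin n → X)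
    (m : Fin M) (i : Fin n) : empirical e (e m i) ≠ 0 := by
  classical
  simp only [empirical, avgInput]
  have h0 : ∀ m' i', (0 : ℝ) ≤ if e m' i' = e m i then 1 else 0 := fun m' i' => by
    split_ifs <;> norm_num
  refine (mul_pos (by positivity) (Finset.sum_pos' (fun m' _ =>
    mul_nonneg (by positivity) (Finset.sum_nonneg fun i' _ => h0 m' i')) ⟨m, Finset.mem_univ m,
      mul_pos (by positivity) (Finset.sum_pos' (fun i' _ => h0 m i')
        ⟨i, Finset.mem_univ i, by simp⟩)⟩)).ne'

/-- A Fano-type converse for a single code. -/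
theorem one_sub_errorProb_mul_log_le (W : StateChannel X S Y) {M n : ℕ} (hM : M ≠ 0) (hn : n ≠ 0)
    (c : Code X S Y M n) :
    (1 - W.errorProb c) * Real.log M - Real.log 2 ≤ n * W.inputInfo (empirical c.encode) := by
  have hM' : (0 : ℝ) < M := by positivity
  have hn' : (n : ℝ) ≠ 0 := by exact_mod_cast hn
  set P := empirical c.encode with hPdef
  have hP : P ∈ stdSimplex ℝ X := empirical_mem hM hn _
  set q := W.output P with hq
  have hqm := W.output_mem hP
  set V : Fin M → (Fin n → Y) → ℝ := fun m y => ∏ i, W.marginal (c.encode m i) (y i) with hV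
  set Q : (Fin n → Y) → ℝ := fun y => ∏ i, q (y i) with hQ
  set F : X → ℝ := fun x => ∑ y, W.marginal x y * Real.log (W.marginal x y / q y) with hF
  -- The weights make `log r` equal to `log M - log 2` on correct decoding and `-log 2` on error,
  -- while `∑ m, r m y ≤ M` for every `y`.
  set r : Fin M → (Fin n → Y) → ℝ := fun m y => if c.decode y ≠ m then 1 / 2 else M / 2 with hr
  have hV0 : ∀ m y, 0 ≤ V m y := fun m y => Finset.prod_nonneg fun i _ => (W.marginal_mem _).1 _
  have hV1 : ∀ m, ∑ y, V m y = 1 := fun m => by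
    simp only [hV]
    rw [sum_pi_prod fun i => W.marginal (c.encode m i)]
    simp [(W.marginal_mem _).2]
  have hQ0 : ∀ y, 0 ≤ Q y := fun y => Finset.prod_nonneg fun i _ => hqm.1 _
  have hQ1 : ∑ y, Q y = 1 := by
    simp only [hQ]
    rw [sum_pi_prod fun _ : Fin n => q]
    simp [hqm.2, hq]
  have hpos : ∀ m y, V m y ≠ 0 → ∀ i, W.marginal (c.encode m i) (y i) ≠ 0 ∧ q (y i) ≠ 0 := by
    intro m y hy i
    have h1 := Finset.prod_ne_zero_iff.1 hy i (Finset.mem_univ i)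
    exact ⟨h1, (W.output_pos hP (empirical_ne_zero hM hn c.encode m i) h1).ne'⟩
  have hlog : ∀ m y, V m y * Real.log (V m y / Q y) =
      ∑ i, V m y * Real.log (W.marginal (c.encode m i) (y i) / q (y i)) := by
    intro m y
    by_cases hy : V m y = 0
    · simp [hy]
    rw [← Finset.mul_sum]
    congr 1
    simp only [hV, hQ, ← Finset.prod_div_distrib]
    exact Real.log_prod fun i _ => div_ne_zero (hpos m y hy i).1 (hpos m y hy i).2
  have hsum : ∀ m, ∑ y, V m y * Real.log (V m y / Q y) = ∑ i, F (c.encode m i) := by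
    intro m
    simp only [hlog]
    rw [Finset.sum_comm]
    exact Finset.sum_congr rfl fun i _ => sum_pi_prod_mul_of_sum_eq_one
      (p := fun i => W.marginal (c.encode m i)) (fun i => (W.marginal_mem _).2) i
      fun y => Real.log (W.marginal (c.encode m i) y / q y)
  have hm : ∀ m, ∑ y, V m y * Real.log (r m y) ≤
      ∑ i, F (c.encode m i) + (∑ y, r m y * Q y - 1) := by
    intro m
    rw [← hsum m, ← hV1 m, ← Finset.sum_sub_distrib, ← Finset.sum_add_distrib]
    refine Finset.sum_le_sum fun y _ => mul_log_le_mul_log_div_add (hV0 m y) (hQ0 y) ?_ ?_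
    · simp only [hr]; split_ifs <;> positivity
    · intro h
      by_contra hy
      exact Finset.prod_ne_zero_iff.2 (fun i _ => (hpos m y hy i).2) h
  have hlhs : ∀ m, ∑ y, V m y * Real.log (r m y) = (Real.log M - Real.log 2) -
      Real.log M * ∑ y, if c.decode y ≠ m then V m y else 0 := by
    intro m
    rw [← mul_one (Real.log M - Real.log 2), ← hV1 m, Finset.mul_sum, Finset.mul_sum,
      ← Finset.sum_sub_distrib]
    refine Finset.sum_congr rfl fun y _ => ?_
    simp only [hr]
    split_ifs
    · rw [Real.log_div one_ne_zero two_ne_zero, Real.log_one]; ring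
    · rw [Real.log_div hM'.ne' two_ne_zero]; ring
  have hrs : ∑ m, ∑ y, r m y * Q y ≤ M := by
    rw [Finset.sum_comm]
    have : ∀ y, ∑ m, r m y * Q y ≤ M * Q y := by
      intro y
      rw [← Finset.sum_mul]
      refine mul_le_mul_of_nonneg_right ?_ (hQ0 y)
      calc ∑ m, r m y ≤ ∑ m, ((1 : ℝ) / 2 + if c.decode y = m then (M : ℝ) / 2 else 0) := by
            refine Finset.sum_le_sum fun m _ => ?_
            by_cases h : c.decode y = m <;> simp [hr, h]
        _ = M := by
            rw [Finset.sum_add_distrib]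
            simp
            ring
    refine (Finset.sum_le_sum fun y _ => this y).trans_eq ?_
    rw [← Finset.mul_sum, hQ1, mul_one]
  -- The reference law `q` is the output law of the averaged input `P`, so the sum is exactly the
  -- information of `P`, with no appeal to concavity.
  have hI : (M : ℝ) * (n * W.inputInfo P) = ∑ m, ∑ i, F (c.encode m i) := by
    rw [inputInfo_eq, hPdef, sum_empirical_mul c.encode F, avgInput, ← Finset.mul_sum]
    field_simp
  have htot := Finset.sum_le_sum fun m (_ : m ∈ Finset.univ) => hm m
  simp only [hlhs, Finset.sum_add_distrib, Finset.sum_sub_distrib, ← hI, ← Finset.mul_sum] at htot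
  simp only [Finset.sum_const, Finset.card_univ, Fintype.card_fin, nsmul_eq_mul, mul_one] at htot
  have hE : ∑ m, ∑ y, (if c.decode y ≠ m then V m y else 0) = M * W.errorProb c := by
    rw [errorProb_eq]
    field_simp
    rfl
  rw [hE] at htot
  refine le_of_mul_le_mul_left ?_ hM'
  linarith

-- A bound uniform in `n` is needed to extract eventual bounds from the real-valued `limsup`.
omit [Fintype X] in
theorem avgDistortion_le_of_le (W : StateChannel X S Y) {d : S → S → ℝ} {B : ℝ} (hB0 : 0 ≤ B)
    (hB : ∀ s s', d s s' ≤ B) {M n : ℕ} (hM : M ≠ 0) (c : Code X S Y M n) :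
    W.avgDistortion d c ≤ B := by
  have hM' : (M : ℝ) ≠ 0 := by exact_mod_cast hM
  have h1 : ∀ (s : Fin n → S) (t : Fin n → S), (1 / (n : ℝ)) * ∑ i, d (s i) (t i) ≤ B := by
    intro s t
    rcases Nat.eq_zero_or_pos n with rfl | hn
    · simpa using hB0
    rw [one_div, inv_mul_le_iff₀ (by positivity)]
    refine (Finset.sum_le_sum fun i _ => hB (s i) (t i)).trans_eq ?_
    simp
  calc W.avgDistortion d c ≤ (1 / (M : ℝ)) * ∑ m : Fin M, ∑ s : Fin n → S, ∑ y : Fin n → Y,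
        W.blockProb (c.encode m) s y * B := by
        unfold avgDistortion
        gcongr with m _ s _ y _
        · exact W.blockProb_nonneg _ _ _
        · exact h1 _ _
    _ = B := by
        have : ∀ m, ∑ s : Fin n → S, ∑ y : Fin n → Y, W.blockProb (c.encode m) s y * B = B := by
          intro m
          rw [Finset.sum_comm]
          simp only [← Finset.sum_mul, sum_blockProb]
          rw [sum_pi_prod fun i => W.marginal (c.encode m i)]
          simp [(W.marginal_mem _).2]
        simp [this, hM']

/-- Passing to a limit law, rather than bounding the rate at `D + ε`, avoids proving continuity of
the maximum in `D`. -/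
theorem Achievable.exists_admissible {W : StateChannel X S Y} {d : S → S → ℝ} {R D : ℝ}
    (hR : W.Achievable d R D) : ∃ P ∈ W.admissible d D, R ≤ W.inputInfo P := by
  obtain ⟨c, hE, hD⟩ := hR
  have hM : ∀ n : ℕ, ⌈Real.exp (n * R)⌉₊ ≠ 0 := fun n => (Nat.ceil_pos.2 (Real.exp_pos _)).ne'
  -- The shift skips blocklength 0, where the empirical law is identically zero.
  set P : ℕ → X → ℝ := fun n => empirical (c (n + 1)).encode with hPdef
  have hP : ∀ n, P n ∈ stdSimplex ℝ X := fun n => empirical_mem (hM _) n.succ_ne_zero _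
  obtain ⟨P₀, hP₀, φ, hφ, hlim⟩ := (isCompact_stdSimplex ℝ X).tendsto_subseq hP
  have hφ' : Tendsto (fun k => φ k + 1) atTop atTop :=
    (tendsto_add_atTop_nat 1).comp hφ.tendsto_atTop
  refine ⟨P₀, ⟨hP₀, ?_⟩, ?_⟩
  · refine le_of_forall_pos_le_add fun ε hε => ?_
    obtain ⟨B, hB⟩ := (Set.finite_range fun p : S × S => d p.1 p.2).bddAbove
    have hbdd : IsBoundedUnder (· ≤ ·) atTop fun n => W.avgDistortion d (c n) :=
      isBoundedUnder_of ⟨max B 0, fun n => W.avgDistortion_le_of_le (le_max_right _ _)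
        (fun s s' => (hB ⟨(s, s'), rfl⟩).trans (le_max_left _ _)) (hM n) _⟩
    have hev := hφ'.eventually (eventually_lt_of_limsup_lt (hD.trans_lt (lt_add_of_pos_right D hε)) hbdd)
    have hcont : Continuous fun P : X → ℝ => ∑ x, P x * W.estimationCost d x := by fun_prop
    refine le_of_tendsto ((hcont.tendsto P₀).comp hlim) (hev.mono fun k hk => ?_)
    simp only [Function.comp, hPdef, sum_empirical_mul]
    exact (W.avgInput_le_avgDistortion d _).trans hk.le
  · have hI : Tendsto (fun k => W.inputInfo (P (φ k))) atTop (𝓝 (W.inputInfo P₀)) :=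
      (W.continuousOn_inputInfo P₀ hP₀).tendsto.comp
        (tendsto_nhdsWithin_iff.2 ⟨hlim, Eventually.of_forall fun k => hP _⟩)
    have hL : Tendsto (fun n : ℕ => (1 - W.errorProb (c n)) * R - Real.log 2 / n) atTop (𝓝 R) := by
      have := ((hE.const_sub 1).mul_const R).sub (tendsto_const_div_atTop_nhds_zero_nat (Real.log 2))
      simpa using this
    have hE1 := hφ'.eventually (hE.eventually (eventually_le_nhds (show (0 : ℝ) < 1 by norm_num)))
    refine le_of_tendsto_of_tendsto (hL.comp hφ') hI (hE1.mono fun k hk => ?_)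
    have h1 := W.one_sub_errorProb_mul_log_le (hM (φ k + 1)) (φ k).succ_ne_zero (c (φ k + 1))
    have hn : (0 : ℝ) < ((φ k + 1 : ℕ) : ℝ) := by positivity
    have h2 : ((φ k + 1 : ℕ) : ℝ) * R ≤ Real.log ⌈Real.exp ((φ k + 1 : ℕ) * R)⌉₊ := by
      rw [Real.le_log_iff_exp_le (by exact_mod_cast Nat.ceil_pos.2 (Real.exp_pos _))]
      exact Nat.le_ceil _
    have h3 := mul_le_mul_of_nonneg_left h2 (sub_nonneg.2 hk)
    refine le_of_mul_le_mul_left ?_ hn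
    simp only [Function.comp, hPdef]
    rw [mul_sub, mul_div_cancel₀ _ hn.ne']
    linarith

end StateChannel

/-! ### Achievability. -/

theorem exists_pos_lt_of_hasDerivAt_neg {f : ℝ → ℝ} {f' x : ℝ} (hf : HasDerivAt f f' x)
    (h : f' < 0) : ∃ t > x, f t < f x := by
  have h1 := (hasDerivAt_iff_tendsto_slope.1 hf).eventually (eventually_lt_nhds h)
  have h2 : ∀ᶠ t in 𝓝[>] x, slope f x t < 0 :=
    h1.filter_mono (nhdsWithin_mono x fun t ht => (ne_of_gt ht : t ≠ x))
  obtain ⟨t, ht, hxt⟩ := (h2.and self_mem_nhdsWithin).exists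
  refine ⟨t, hxt, ?_⟩
  rw [slope_def_field, div_neg_iff] at ht
  have : x < t := hxt
  rcases ht with ht | ht <;> linarith

namespace StateChannel
variable {X S Y : Type*} [Fintype X] [Fintype S] [Fintype Y]

/-- As a function of `t`, the sum is 1 at 0 and has derivative `a - I(P) < 0` there. -/
theorem exists_chernoff_lt_one (W : StateChannel X S Y) {P : X → ℝ} (hP : P ∈ stdSimplex ℝ X)
    {a : ℝ} (ha : a < W.inputInfo P) :
    ∃ t : ℝ, t > 0 ∧ ∑ x, P x * ∑ y, W.marginal x y *
      (Real.exp a * W.output P y / W.marginal x y) ^ t < 1 := by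
  set f : ℝ → ℝ := fun t => ∑ x, ∑ y, P x * W.marginal x y *
    (Real.exp a * W.output P y / W.marginal x y) ^ t with hf
  have hf' : ∀ t : ℝ, ∑ x, P x * ∑ y, W.marginal x y *
      (Real.exp a * W.output P y / W.marginal x y) ^ t = f t := fun t => by
    simp only [hf, Finset.mul_sum, mul_assoc]
  have h0 : f 0 = 1 := by
    simp [hf, ← Finset.mul_sum, (W.marginal_mem _).2, hP.2]
  have hsub : a - W.inputInfo P = ∑ x, ∑ y, P x * W.marginal x y *
      Real.log (Real.exp a * W.output P y / W.marginal x y) := by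
    have h1 : a = ∑ x, ∑ y, P x * W.marginal x y * a := by
      simp [← Finset.sum_mul, ← Finset.mul_sum, (W.marginal_mem _).2, hP.2]
    conv_lhs => rw [h1, inputInfo_eq]
    rw [← Finset.sum_sub_distrib]
    refine Finset.sum_congr rfl fun x _ => ?_
    rw [Finset.mul_sum, ← Finset.sum_sub_distrib]
    refine Finset.sum_congr rfl fun y _ => ?_
    by_cases hx : P x = 0
    · simp [hx]
    by_cases hv : W.marginal x y = 0
    · simp [hv]
    have hq := (W.output_pos hP hx hv).ne'
    rw [Real.log_div (mul_ne_zero (Real.exp_pos a).ne' hq) hv, Real.log_div hv hq,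
      Real.log_mul (Real.exp_pos a).ne' hq, Real.log_exp]
    ring
  have hder : HasDerivAt f (a - W.inputInfo P) 0 := by
    rw [hsub]
    refine HasDerivAt.fun_sum fun x _ => HasDerivAt.fun_sum fun y _ => ?_
    by_cases hx : P x = 0
    · simpa [hx] using hasDerivAt_const (0 : ℝ) (0 : ℝ)
    by_cases hv : W.marginal x y = 0
    · simpa [hv] using hasDerivAt_const (0 : ℝ) (0 : ℝ)
    have hb : 0 < Real.exp a * W.output P y / W.marginal x y :=
      div_pos (mul_pos (Real.exp_pos a) (W.output_pos hP hx hv))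
        (((W.marginal_mem x).1 y).lt_of_ne' hv)
    refine HasDerivAt.const_mul _ ?_
    have := Real.hasStrictDerivAt_const_rpow hb 0
    simpa using this.hasDerivAt
  obtain ⟨t, ht, hlt⟩ := exists_pos_lt_of_hasDerivAt_neg hder (sub_neg.2 ha)
  exact ⟨t, ht, by rw [hf', ← h0]; exact hlt⟩

theorem prod_mem_stdSimplex {α : Type*} [Fintype α] {n : ℕ} {p : Fin n → α → ℝ}
    (hp : ∀ i, p i ∈ stdSimplex ℝ α) :
    (fun x : Fin n → α => ∏ i, p i (x i)) ∈ stdSimplex ℝ (Fin n → α) := by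
  refine ⟨fun x => Finset.prod_nonneg fun i _ => (hp i).1 _, ?_⟩
  rw [sum_pi_prod p]
  simp [(hp _).2]

/-- Random coding at rate `R < I(X; Y)`: the sum of the input cost and `K` times the error
probability can be made as small as the expected cost plus an exponentially small multiple
of `K`. -/
theorem exists_code_avgInput_add_error_le (W : StateChannel X S Y) {P : X → ℝ}
    (hP : P ∈ stdSimplex ℝ X) (b : X → ℝ) {R : ℝ} (hR : R < W.inputInfo P) :
    ∃ r : ℝ, 0 < r ∧ r < 1 ∧ ∀ n : ℕ, n ≠ 0 → ∀ K : ℝ, 0 ≤ K →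
      ∃ (e : Fin ⌈Real.exp (n * R)⌉₊ → Fin n → X) (g : (Fin n → Y) → Fin ⌈Real.exp (n * R)⌉₊),
        ∀ h : (Fin n → Y) → Fin n → S,
          avgInput e b + K * W.errorProb ⟨e, g, h⟩ ≤ ∑ x, P x * b x + K * (2 * r ^ n) := by
  obtain ⟨a, hRa, haI⟩ := exists_between hR
  obtain ⟨t, ht, hφ⟩ := W.exists_chernoff_lt_one hP haI
  set φ := ∑ x, P x * ∑ y, W.marginal x y *
    (Real.exp a * W.output P y / W.marginal x y) ^ t with hφdef
  have hq := W.output_mem hP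
  have hφ0 : 0 ≤ φ := Finset.sum_nonneg fun x _ => mul_nonneg (hP.1 x) <|
    Finset.sum_nonneg fun y _ => mul_nonneg ((W.marginal_mem x).1 y) <| Real.rpow_nonneg
      (div_nonneg (mul_nonneg (Real.exp_pos a).le (hq.1 y)) ((W.marginal_mem x).1 y)) t
  -- `φ ^ n` bounds the failure of the threshold test at `exp (n * a)`, and `exp (R - a) ^ n` bounds
  -- the confusion with other codewords.
  refine ⟨max φ (Real.exp (R - a)), lt_max_of_lt_right (Real.exp_pos _),
    max_lt hφ (Real.exp_lt_one_iff.2 (sub_neg.2 hRa)), fun n hn K hK => ?_⟩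
  obtain ⟨e, g, heg⟩ := exists_code_cost_add_error_le
    (prod_mem_stdSimplex fun _ : Fin n => hP)
    (fun x : Fin n → X => prod_mem_stdSimplex fun i => W.marginal_mem (x i))
    (fun x => (1 / (n : ℝ)) * ∑ i, b (x i)) (Nat.ceil_pos.2 (Real.exp_pos (n * R)))
    (Real.exp_pos (n * a)) hK
  refine ⟨e, g, fun h => ?_⟩
  rw [avgInput, errorProb_eq]
  refine heg.trans (add_le_add (le_of_eq ?_) (mul_le_mul_of_nonneg_left ?_ hK))
  · have hn' : (n : ℝ) ≠ 0 := by exact_mod_cast hn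
    simp only [Finset.mul_sum]
    rw [Finset.sum_comm]
    have : ∀ i : Fin n, ∑ x : Fin n → X, (∏ i, P (x i)) * (1 / (n : ℝ) * b (x i)) =
        ∑ x, P x * (1 / (n : ℝ) * b x) := fun i =>
      sum_pi_prod_mul_of_sum_eq_one (p := fun _ => P) (fun _ => hP.2) i fun x => 1 / (n : ℝ) * b x
    simp only [this, Finset.sum_const, Finset.card_univ, Fintype.card_fin, nsmul_eq_mul,
      Finset.mul_sum]
    refine Finset.sum_congr rfl fun x _ => ?_
    field_simp
  · have hout : ∀ y : Fin n → Y, ∑ x' : Fin n → X,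
        (∏ i, P (x' i)) * ∏ i, W.marginal (x' i) (y i) = ∏ i, W.output P (y i) := fun y => by
      simp only [← Finset.prod_mul_distrib, output]
      exact sum_pi_prod fun i x => P x * W.marginal x (y i)
    simp only [hout]
    have h1 := sum_prod_lt_le_pow hP.1 (fun x => (W.marginal_mem x).1) hq.1 n (a := a) ht.le
    have h2 : ((⌈Real.exp (n * R)⌉₊ : ℝ) - 1) / Real.exp (n * a) ≤ Real.exp (R - a) ^ n := by
      rw [← Real.exp_nat_mul, mul_sub, Real.exp_sub]
      gcongr
      linarith [Nat.ceil_lt_add_one (Real.exp_pos (n * R)).le]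
    have h3 := pow_le_pow_left₀ hφ0 (le_max_left φ (Real.exp (R - a))) n
    have h4 := pow_le_pow_left₀ (Real.exp_pos (R - a)).le (le_max_right φ (Real.exp (R - a))) n
    linarith

omit [Fintype X] in
theorem errorProb_nonneg (W : StateChannel X S Y) {M n : ℕ} (c : Code X S Y M n) :
    0 ≤ W.errorProb c := by
  refine mul_nonneg (by positivity) (Finset.sum_nonneg fun m _ => Finset.sum_nonneg fun s _ =>
    Finset.sum_nonneg fun y _ => ?_)
  split_ifs
  · exact W.blockProb_nonneg _ _ _
  · exact le_rfl

omit [Fintype X] in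
theorem avgInput_nonneg {M n : ℕ} (e : Fin M → Fin n → X) {b : X → ℝ} (hb : ∀ x, 0 ≤ b x) :
    0 ≤ avgInput e b :=
  mul_nonneg (by positivity) (Finset.sum_nonneg fun m _ =>
    mul_nonneg (by positivity) (Finset.sum_nonneg fun i _ => hb _))

theorem achievable_of_lt_inputInfo [Nonempty X] (W : StateChannel X S Y) {d : S → S → ℝ}
    (hd : ∀ s s', 0 ≤ d s s') {R D : ℝ} {P : X → ℝ} (hP : P ∈ W.admissible d D)
    (hR : R < W.inputInfo P) : W.Achievable d R D := by
  obtain ⟨r, hr0, hr1, hcode⟩ :=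
    W.exists_code_avgInput_add_error_le hP.1 (W.estimationCost d) hR
  obtain ⟨h, -, hh⟩ := W.exists_optimal_estimator d
  obtain ⟨B, hB⟩ := (Set.finite_range fun p : S × S => d p.1 p.2).bddAbove
  have hB' : ∀ s s', d s s' ≤ B := fun s s' => hB ⟨(s, s'), rfl⟩
  have hB0 : 0 ≤ B := by
    obtain ⟨s⟩ := W.nonempty_state
    exact (hd s s).trans (hB' s s)
  have hcost := W.estimationCost_nonneg hd
  -- With `K = 1 / δ n` the penalty `K * (2 * r ^ n)` equals `δ n`. As cost and error are both
  -- nonnegative, the cost is at most `D + δ n` and the error at most `(D + δ n) * δ n`.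
  set δ : ℕ → ℝ := fun n => √(2 * r ^ n) with hδ
  have hδ0 : ∀ n, 0 < δ n := fun n => Real.sqrt_pos.2 (by positivity)
  have hδlim : Tendsto δ atTop (𝓝 0) := by
    have := ((tendsto_pow_atTop_nhds_zero_of_lt_one hr0.le hr1).const_mul 2).sqrt
    rwa [mul_zero, Real.sqrt_zero] at this
  have hex : ∀ n : ℕ, ∃ c : Code X S Y ⌈Real.exp (n * R)⌉₊ n, n ≠ 0 →
      W.errorProb c ≤ (D + δ n) * δ n ∧
      W.avgDistortion d c ≤ D + δ n + B * W.errorProb c := by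
    intro n
    by_cases hn : n = 0
    · have : Nonempty S := W.nonempty_state
      have hM : 0 < ⌈Real.exp (n * R)⌉₊ := Nat.ceil_pos.2 (Real.exp_pos _)
      exact ⟨⟨fun _ _ => Classical.arbitrary X, fun _ => ⟨0, hM⟩,
        fun _ _ => Classical.arbitrary S⟩, fun h => absurd hn h⟩
    obtain ⟨e, g, heg⟩ := hcode n hn (1 / δ n) (one_div_nonneg.2 (hδ0 n).le)
    have h1 := heg fun y i => h (e (g y) i) (y i)
    have h2 := W.avgDistortion_le hd hB' hh hn e g
    refine ⟨⟨e, g, fun y i => h (e (g y) i) (y i)⟩, fun _ => ⟨?_, ?_⟩⟩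
    all_goals
      set E := W.errorProb ⟨e, g, fun y i => h (e (g y) i) (y i)⟩
      have hE : 0 ≤ E := W.errorProb_nonneg _
      have h3 : 1 / δ n * (2 * r ^ n) = δ n := by
        rw [one_div, inv_mul_eq_iff_eq_mul₀ (hδ0 n).ne', hδ]
        exact (Real.mul_self_sqrt (by positivity)).symm
      rw [h3] at h1
      have h4 := hP.2
      have h5 := avgInput_nonneg e hcost
    · rw [← div_le_iff₀ (hδ0 n), div_eq_inv_mul, ← one_div]
      linarith
    · have := mul_nonneg (one_div_nonneg.2 (hδ0 n).le) hE
      linarith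
  choose c hc using hex
  have hE : Tendsto (fun n => W.errorProb (c n)) atTop (𝓝 0) := by
    have : Tendsto (fun n => (D + δ n) * δ n) atTop (𝓝 0) := by
      simpa using (hδlim.const_add D).mul hδlim
    refine tendsto_of_tendsto_of_tendsto_of_le_of_le' tendsto_const_nhds this
      (Eventually.of_forall fun n => W.errorProb_nonneg _) ?_
    filter_upwards [eventually_ne_atTop 0] with n hn using (hc n hn).1
  refine ⟨c, hE, le_of_forall_pos_lt_add fun ε hε => ?_⟩
  have hu : Tendsto (fun n => D + δ n + B * W.errorProb (c n)) atTop (𝓝 D) := by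
    simpa using (hδlim.const_add D).add (hE.const_mul B)
  have hco : IsCoboundedUnder (· ≤ ·) atTop fun n => W.avgDistortion d (c n) := by
    refine IsBoundedUnder.isCoboundedUnder_le (isBoundedUnder_of ⟨0, fun n => ?_⟩)
    exact (avgInput_nonneg _ hcost).trans (W.avgInput_le_avgDistortion d (c n))
  refine lt_of_le_of_lt (limsup_le_of_le (a := D + ε / 2) hco ?_) (by linarith)
  filter_upwards [eventually_ne_atTop 0, hu.eventually (eventually_le_nhds
    (show D < D + ε / 2 by linarith))] with n hn hn2 using (hc n hn).2.trans hn2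

/-! ### The admissible set and the main theorem. -/

theorem isCompact_admissible (W : StateChannel X S Y) (d : S → S → ℝ) (D : ℝ) :
    IsCompact (W.admissible d D) := by
  have hcont : Continuous fun P : X → ℝ => ∑ x, P x * W.estimationCost d x := by fun_prop
  exact (isCompact_stdSimplex ℝ X).inter_right (isClosed_le hcont continuous_const)

theorem admissible_nonempty (W : StateChannel X S Y) {d : S → S → ℝ} {D : ℝ}
    (h : ∃ x, W.estimationCost d x ≤ D) : (W.admissible d D).Nonempty := by
  classical
  obtain ⟨x, hx⟩ := h
  refine ⟨Pi.single x 1, single_mem_stdSimplex ℝ x, ?_⟩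
  simpa [Pi.single_apply] using hx

theorem admissible_eq_empty (W : StateChannel X S Y) {d : S → S → ℝ} {D : ℝ}
    (h : ∀ x, D < W.estimationCost d x) : W.admissible d D = ∅ := by
  refine Set.eq_empty_of_forall_notMem fun P hP => ?_
  obtain ⟨x, hx⟩ := exists_le_of_sum_mul_le hP.1.1 hP.1.2 hP.2
  exact hx.not_gt (h x)

end StateChannel
end CapacityDistortion

theorem theorem1 {X S Y : Type*} [Fintype X] [Fintype S] [Fintype Y] [Nonempty X]
    (W : CapacityDistortion.StateChannel X S Y)
    (d : S → S → ℝ) (hd : ∀ s s', 0 ≤ d s s') (D : ℝ) (hD : 0 ≤ D) :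
    ((∃ x, W.estimationCost d x ≤ D) →
      ∃ P ∈ W.admissible d D,
        (∀ Q ∈ W.admissible d D, W.inputInfo Q ≤ W.inputInfo P) ∧
        W.capacityDistortion d D = (W.inputInfo P : EReal)) ∧
    ((∀ x, D < W.estimationCost d x) →
      W.admissible d D = ∅ ∧ ∀ R : ℝ, ¬ W.Achievable d R D) := by
  refine ⟨fun h => ?_, fun h => ⟨W.admissible_eq_empty h, fun R hR => ?_⟩⟩
  · obtain ⟨P, hP, hmax⟩ := (W.isCompact_admissible d D).exists_isMaxOn (W.admissible_nonempty h)
      (W.continuousOn_inputInfo.mono fun P hP => hP.1)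
    refine ⟨P, hP, fun Q hQ => hmax hQ, le_antisymm (sSup_le ?_) ?_⟩
    · rintro _ ⟨R, hR, rfl⟩
      obtain ⟨Q, hQ, hRQ⟩ := hR.exists_admissible
      exact EReal.coe_le_coe_iff.2 (hRQ.trans (hmax hQ))
    -- Rates strictly below the maximum suffice for the supremum. If the maximum is 0 these are
    -- negative rates, whose codes have a single message.
    · by_contra! hlt
      obtain ⟨R, h1, h2⟩ := EReal.lt_iff_exists_real_btwn.1 hlt
      exact (le_sSup ⟨R, W.achievable_of_lt_inputInfo hd hP (EReal.coe_lt_coe_iff.1 h2), rfl⟩ :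
        (R : EReal) ≤ W.capacityDistortion d D).not_gt h1
  · obtain ⟨P, hP, -⟩ := hR.exists_admissible
    rw [W.admissible_eq_empty h] at hP
    exact hP
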